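/- Let $k\ge 0$ be an integer and let $\Omega\subset\mathbb{R}$ be a nonempty open set. Let $C^k(\Omega)$ be the space of $k$ times continuously differentiable functions $f\colon\Omega\to\mathbb{R}$, and $C(\Omega)=C^0(\Omega)$. For an arbitrary (not necessarily linear) operator $D\colon C^k(\Omega)\to C(\Omega)$ consider the identity $$D(fgh)-fD(gh)-gD(fh)-hD(fg)+fg\,D(h)+fh\,D(g)+gh\,D(f)=0\qquad(f,g,h\in C^k(\Omega)).\tag{1}$$ If $D$ satisfies (1), then there exist functions $c_0,c_1,c_2,d_{00}\in C(\Omega)$, with $c_1=c_2=0$ if $k=0$ and $c_2=0$ if $k=1$, such that $$D(f)(x)=c_0(x)f(x)\ln|f(x)|+c_1(x)f'(x)+c_2(x)f''(x)+d_{00}(x)f(x)\bigl(\ln|f(x)|\bigr)^2\tag{2}$$ for all $f\in C^k(\Omega)$ and $x\in\Omega$. Here $0\ln 0=0$ and $0(\ln 0)^2=0$, and a term whose coefficient function is identically zero is omitted. Conversely, for all $c_0,c_1,c_2,d_{00}\in C(\Omega)$ such that $c_1=c_2=0$ if $k=0$ and $c_2=0$ if $k=1$, formula (2) defines an operator $D\colon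 C^k(\Omega)\to C(\Omega)$, and this operator satisfies (1). -/

import Mathlib

noncomputable section

/-- The extension by zero to `ℝ` of a function on `Ω`. It is only a device for speaking about
derivatives: for open `Ω` its derivatives at points of `Ω` depend on `f` alone. -/
def extendByZero {Ω : Set ℝ} (f : Ω → ℝ) : ℝ → ℝ :=
  Function.extend Subtype.val f 0

theorem extendByZero_apply {Ω : Set ℝ} (f : Ω → ℝ) (x : Ω) : extendByZero f x = f x :=
  Subtype.val_injective.extend_apply f 0 x

/-- The space of `k` times continuously differentiable functions `f : Ω → ℝ` (for open `Ω`),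
as a subalgebra of the algebra of all functions `Ω → ℝ` with pointwise operations. -/
def CkSpace (k : ℕ) (Ω : Set ℝ) : Subalgebra ℝ (Ω → ℝ) where
  carrier := {f | ContDiffOn ℝ k (extendByZero f) Ω}
  mul_mem' {f g} hf hg := (ContDiffOn.mul hf hg).congr fun x hx => by
    simp only [extendByZero_apply _ ⟨x, hx⟩, Pi.mul_apply]
  add_mem' {f g} hf hg := (ContDiffOn.add hf hg).congr fun x hx => by
    simp only [extendByZero_apply _ ⟨x, hx⟩, Pi.add_apply]
  algebraMap_mem' r := (contDiffOn_const (c := r)).congr fun x hx => by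
    simp only [extendByZero_apply _ ⟨x, hx⟩, Pi.algebraMap_apply, Algebra.algebraMap_self,
      RingHom.id_apply]

/-- The first derivative `f'(x)` of a function on `Ω`, at `x ∈ Ω`. -/
def firstDeriv {Ω : Set ℝ} (f : Ω → ℝ) (x : Ω) : ℝ :=
  deriv (extendByZero f) x

/-- The second derivative `f''(x)` of a function on `Ω`, at `x ∈ Ω`. -/
def secondDeriv {Ω : Set ℝ} (f : Ω → ℝ) (x : Ω) : ℝ :=
  deriv (deriv (extendByZero f)) x

/-- The three-variable identity
`D(fgh) - f D(gh) - g D(fh) - h D(fg) + fg D(h) + fh D(g) + gh D(f) = 0`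
for an arbitrary operator `D : C^k(Ω) → C(Ω)`. -/
def ThreeVariableIdentity {k : ℕ} {Ω : Set ℝ} (D : CkSpace k Ω → C(Ω, ℝ)) : Prop :=
  ∀ (f g h : CkSpace k Ω) (x : Ω),
    D (f * g * h) x - f.val x * D (g * h) x - g.val x * D (f * h) x - h.val x * D (f * g) x
      + f.val x * g.val x * D h x + f.val x * h.val x * D g x + g.val x * h.val x * D f x = 0

/-- `D(f)(x) = c₀ f ln|f| + c₁ f' + c₂ f'' + d₀₀ f (ln|f|)²` at every `x ∈ Ω`, for all
`f ∈ C^k(Ω)`. As `Real.log 0 = 0`, both `f ln|f|` and `f (ln|f|)²` are `0` where `f` vanishes. -/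
def HasForm {k : ℕ} {Ω : Set ℝ} (D : CkSpace k Ω → C(Ω, ℝ)) (c₀ c₁ c₂ d₀₀ : C(Ω, ℝ)) : Prop :=
  ∀ (f : CkSpace k Ω) (x : Ω),
    D f x = c₀ x * f.val x * Real.log |f.val x| + c₁ x * firstDeriv f.val x + c₂ x * secondDeriv f.val x
      + d₀₀ x * f.val x * (Real.log |f.val x|) ^ 2

/-- The coefficients of derivatives of order greater than `k` vanish. -/
def AdmissibleCoeffs {Ω : Set ℝ} (k : ℕ) (c₁ c₂ : C(Ω, ℝ)) : Prop :=
  (k = 0 → c₁ = 0 ∧ c₂ = 0) ∧ (k = 1 → c₂ = 0)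

end

open Filter Topology Asymptotics Set Metric

/-! On exponentials the identity becomes additive: for G(φ) = D(e^φ)/e^φ it says that the third
difference of G vanishes and G(0) = 0. Hence G(φ) = A(φ) + B(φ, φ) with A additive and B symmetric
and biadditive (`ThreeVariableIdentity.exists_linear_bilinear`).

No continuity of D is assumed; the only regularity is that D, A and B take values in continuous
functions. Together with locality this is used twice. A gliding hump shows that local operators are
bounded on small two-parameter families at a dense set of points (`IsLocalOperator.dense_bounded`),
which makes A and B linear. Cutting a flat function off on one side of x shows that A(φ)(x) and B(ψ,
φ)(x) depend on φ only through its k-jet at x (`IsLocalOperator.eq_zero_of_isLittleO`).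

For f(x) > 0 write f = f(x)(1 - v) and deform it to s(1 - Mv). Modulo flat functions, log(1 - Mv) is
a polynomial in M, so D(s(1 - Mv))(x) = s(a₀ log s + b₀ log² s + 2 log s · q(M) + r(M)) with
polynomials q and r. At a point of the dense set this stays bounded while s and sM are small, so q =
0 and r is linear (`Polynomial.eval_eq_of_bounded`). Thus D f = A(1) f log f + B(1, 1) f log² f + A
f - f A(1) there (`IsLocalOperator.apply_eq_of_pos`). Applying the identity to 1 + u, 1 + v, 1 + w
shows that A kills products of three functions vanishing at x, so A is a differential operator of
order at most two. Oddness of D covers f(x) < 0; density and locality cover the remaining points. -/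

/-! ### Germs and the space C^k(Ω) -/

theorem extendByZero_eventuallyEq_of_eqOn {Ω : Set ℝ} (hΩ : IsOpen Ω) (x : Ω) {f : Ω → ℝ}
    {g : ℝ → ℝ} (h : ∀ y : Ω, f y = g y) : extendByZero f =ᶠ[𝓝 (x : ℝ)] g := by
  filter_upwards [hΩ.mem_nhds x.2] with y hy
  rw [extendByZero_apply f ⟨y, hy⟩, h]

theorem eventuallyEq_of_eventually_apply {Ω : Set ℝ} (hΩ : IsOpen Ω) (x : Ω) {f g : Ω → ℝ}
    (h : ∀ᶠ y in 𝓝 x, f y = g y) : extendByZero f =ᶠ[𝓝 (x : ℝ)] extendByZero g := by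
  have : Filter.map Subtype.val (𝓝 x) = 𝓝 (x : ℝ) := hΩ.isOpenEmbedding_subtypeVal.map_nhds_eq x
  rw [← this]
  refine Filter.eventually_map.2 ?_
  simpa only [extendByZero_apply] using h

theorem extendByZero_mul {Ω : Set ℝ} (f g : Ω → ℝ) :
    extendByZero (f * g) = extendByZero f * extendByZero g := by
  funext y
  by_cases hy : y ∈ Ω
  · simp [extendByZero_apply _ ⟨y, hy⟩]
  · have : ¬ ∃ a : Ω, (a : ℝ) = y := fun ⟨a, ha⟩ => hy (ha ▸ a.2)
    simp [extendByZero, Function.extend_apply' _ _ _ this]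

theorem extendByZero_add {Ω : Set ℝ} (f g : Ω → ℝ) :
    extendByZero (f + g) = extendByZero f + extendByZero g := by
  funext y
  by_cases hy : y ∈ Ω
  · simp [extendByZero_apply _ ⟨y, hy⟩]
  · have : ¬ ∃ a : Ω, (a : ℝ) = y := fun ⟨a, ha⟩ => hy (ha ▸ a.2)
    simp [extendByZero, Function.extend_apply' _ _ _ this]

theorem CkSpace.contDiffAt {k : ℕ} {Ω : Set ℝ} (hΩ : IsOpen Ω) (f : CkSpace k Ω) (x : Ω) :
    ContDiffAt ℝ k (extendByZero f.val) x :=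
  ContDiffOn.contDiffAt f.2 (hΩ.mem_nhds x.2)

theorem CkSpace.continuous {k : ℕ} {Ω : Set ℝ} (f : CkSpace k Ω) : Continuous f.val := by
  have h : ContinuousOn (extendByZero f.val) Ω := ContDiffOn.continuousOn f.2
  refine (continuousOn_iff_continuous_domRestrict.1 h).congr fun x => ?_
  simp [extendByZero_apply]

/-- The restriction to `Ω` of a `C^k` function on the line. -/
def CkSpace.ofContDiff {k : ℕ} (Ω : Set ℝ) (g : ℝ → ℝ) (hg : ContDiff ℝ k g) : CkSpace k Ω :=
  ⟨fun y => g y, (hg.contDiffOn (s := Ω)).congr fun y hy => extendByZero_apply _ ⟨y, hy⟩⟩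

theorem CkSpace.extendByZero_ofContDiff {k : ℕ} {Ω : Set ℝ} (hΩ : IsOpen Ω) (x : Ω) (g : ℝ → ℝ)
    (hg : ContDiff ℝ k g) :
    extendByZero (CkSpace.ofContDiff Ω g hg).val =ᶠ[𝓝 (x : ℝ)] g :=
  extendByZero_eventuallyEq_of_eqOn hΩ x fun _ => rfl

theorem ContDiffBump.contDiff_mul {k : ℕ} {c : ℝ} (β : ContDiffBump c) {g : ℝ → ℝ}
    (hg : ∀ y ∈ closedBall c β.rOut, ContDiffAt ℝ k g y) :
    ContDiff ℝ k (fun y => β y * g y) := by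
  rw [contDiff_iff_contDiffAt]
  intro y
  by_cases hy : y ∈ closedBall c β.rOut
  · exact β.contDiffAt.mul (hg y hy)
  · have h : (fun y => β y * g y) =ᶠ[𝓝 y] fun _ => 0 := by
      filter_upwards [isClosed_closedBall.isOpen_compl.mem_nhds hy] with z hz
      have : β z = 0 := β.zero_of_le_dist (by
        simp only [mem_compl_iff, mem_closedBall, not_le] at hz; exact hz.le)
      simp [this]
    exact contDiffAt_const.congr_of_eventuallyEq h

theorem exists_contDiff_eventuallyEq {k : ℕ} {g : ℝ → ℝ} {x : ℝ} (hg : ContDiffAt ℝ k g x) :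
    ∃ G : ℝ → ℝ, ContDiff ℝ k G ∧ G =ᶠ[𝓝 x] g := by
  have h1 : ∀ᶠ y in 𝓝 x, ContDiffAt ℝ k g y := hg.eventually (by simp)
  obtain ⟨r, hr, hb⟩ := Metric.eventually_nhds_iff_ball.1 h1
  let β : ContDiffBump x := ⟨r / 4, r / 2, by linarith, by linarith⟩
  refine ⟨fun y => β y * g y, β.contDiff_mul fun y hy => hb y ?_, ?_⟩
  · have : dist y x ≤ r / 2 := hy
    rw [mem_ball]; linarith
  · filter_upwards [β.eventuallyEq_one] with y hy
    simp [hy]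

theorem CkSpace.exists_eventuallyEq {k : ℕ} {Ω : Set ℝ} (hΩ : IsOpen Ω) (x : Ω) {g : ℝ → ℝ}
    (hg : ContDiffAt ℝ k g x) : ∃ φ : CkSpace k Ω, extendByZero φ.val =ᶠ[𝓝 (x : ℝ)] g := by
  obtain ⟨G, hG, hGg⟩ := exists_contDiff_eventuallyEq hg
  exact ⟨CkSpace.ofContDiff Ω G hG, (CkSpace.extendByZero_ofContDiff hΩ x G hG).trans hGg⟩

/-! ### Locality -/

/-- `T f x` depends only on the germ of `f` at `x`. -/
def IsLocalOperator {k : ℕ} {Ω : Set ℝ} (T : CkSpace k Ω → C(Ω, ℝ)) : Prop :=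
  ∀ (f g : CkSpace k Ω) (x : Ω),
    extendByZero f.val =ᶠ[𝓝 (x : ℝ)] extendByZero g.val → T f x = T g x

/-- For a bump b equal to 1 near x and supported where f = g, one has fb = gb. The identity for (f,
b, b) and for (g, b, b) then expresses both values through the same data. -/
theorem ThreeVariableIdentity.isLocalOperator {k : ℕ} {Ω : Set ℝ}
    {D : CkSpace k Ω → C(Ω, ℝ)} (hD : ThreeVariableIdentity D) : IsLocalOperator D := by
  intro f g x h
  obtain ⟨r, hr, hb⟩ := Metric.eventually_nhds_iff_ball.1 h
  let β : ContDiffBump (x : ℝ) := ⟨r / 4, r / 2, by linarith, by linarith⟩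
  let b : CkSpace k Ω := CkSpace.ofContDiff Ω β β.contDiff
  have hbx : b.val x = 1 := β.eventuallyEq_one.eq_of_nhds
  have hfg : f * b = g * b := by
    apply Subtype.ext
    funext y
    change f.val y * β y = g.val y * β y
    by_cases hy : (y : ℝ) ∈ ball (x : ℝ) r
    · have := hb y hy
      rw [extendByZero_apply, extendByZero_apply] at this
      rw [this]
    · have : β (y : ℝ) = 0 := β.zero_of_le_dist (by
        simp only [mem_ball, not_lt] at hy
        change r / 2 ≤ _
        linarith)
      simp [this]
  have hx : f.val x = g.val x := by simpa [extendByZero_apply] using h.eq_of_nhds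
  have h1 := hD f b b x
  have h2 := hD g b b x
  rw [hfg, hx, hbx] at h1
  rw [hbx] at h2
  linarith

/-! ### Boundedness on a dense set -/

theorem ContDiff.exists_bound_iteratedFDeriv {k : ℕ} {g : ℝ → ℝ} (hg : ContDiff ℝ k g)
    (hc : HasCompactSupport g) :
    ∃ K : ℝ, 0 ≤ K ∧ ∀ j ≤ k, ∀ y, ‖iteratedFDeriv ℝ j g y‖ ≤ K := by
  have h (j : ℕ) (hj : j ≤ k) : ∃ C, ∀ y, ‖iteratedFDeriv ℝ j g y‖ ≤ C :=
    (hg.continuous_iteratedFDeriv (by exact_mod_cast hj)).bounded_above_of_compact_support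
      (hc.iteratedFDeriv j)
  choose! C hC using h
  refine ⟨∑ j ∈ Finset.range (k + 1), |C j|, Finset.sum_nonneg fun _ _ => abs_nonneg _, ?_⟩
  intro j hj y
  exact ((hC j hj y).trans (le_abs_self _)).trans
    (Finset.single_le_sum (f := fun j => |C j|) (fun _ _ => abs_nonneg _)
      (Finset.mem_range.2 (by omega)))

/-- Gliding hump: if an open set consists of bad points, take bad points x_n → x₀ in it and glue
tiny bad functions near each x_n into one C^k function f with |T f(x_n)| > n, contradicting
continuity of T f at x₀. One parameter would suffice for homogeneity; the second is needed for the
family s(1 - Mv). -/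
theorem IsLocalOperator.dense_bounded {k : ℕ} {Ω : Set ℝ} (hΩ : IsOpen Ω)
    {T : CkSpace k Ω → C(Ω, ℝ)} (hT : IsLocalOperator T) :
    Dense {x : Ω | ∀ u w : CkSpace k Ω, ∃ ε > 0, ∃ C, ∀ s t : ℝ, |s| < ε → |t| < ε →
      |T (s • u + t • w) x| ≤ C} := by
  by_contra hnd
  rw [dense_iff_inter_open] at hnd
  push Not at hnd
  obtain ⟨V, hV, ⟨x₀, hx₀⟩, hVe⟩ := hnd
  obtain ⟨W, hW, rfl⟩ := isOpen_induced_iff.1 hV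
  obtain ⟨δ, hδ, hball⟩ := Metric.isOpen_iff.1 (hW.inter hΩ) (x₀ : ℝ) ⟨hx₀, x₀.2⟩
  -- Halving the distances keeps the balls of radius d n / 4 about x₀ + d n pairwise disjoint.
  set d : ℕ → ℝ := fun n => δ / 2 * (1 / 2) ^ n with hd
  have hd0 (n) : 0 < d n := by positivity
  have hdδ (n) : d n ≤ δ / 2 := by
    have : ((1 : ℝ) / 2) ^ n ≤ 1 := pow_le_one₀ (by norm_num) (by norm_num)
    simp only [hd]
    nlinarith
  have hdlt {m n : ℕ} (h : m < n) : d n ≤ d m / 2 := by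
    have : ((1 : ℝ) / 2) ^ n ≤ (1 / 2) ^ (m + 1) :=
      pow_le_pow_of_le_one (by norm_num) (by norm_num) h
    rw [pow_succ] at this
    simp only [hd]
    nlinarith
  have hmem (n) : ∀ y ∈ closedBall ((x₀ : ℝ) + d n) (d n / 4), y ∈ W ∩ Ω := by
    intro y hy
    apply hball
    rw [mem_closedBall, Real.dist_eq, abs_le] at hy
    rw [mem_ball, Real.dist_eq, abs_lt]
    have := hd0 n
    have := hdδ n
    constructor <;> linarith
  have hxm (n) : (x₀ : ℝ) + d n ∈ W ∩ Ω :=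
    hmem n _ (mem_closedBall_self (by have := hd0 n; linarith))
  let x : ℕ → Ω := fun n => ⟨x₀ + d n, (hxm n).2⟩
  have hbad (n : ℕ) : ∃ u w : CkSpace k Ω, ∀ ε > 0, ∀ C, ∃ s t : ℝ, |s| < ε ∧ |t| < ε ∧
      C < |T (s • u + t • w) (x n)| := by
    have h : x n ∉ {x : Ω | ∀ u w : CkSpace k Ω, ∃ ε > 0, ∃ C, ∀ s t : ℝ, |s| < ε → |t| < ε →
      |T (s • u + t • w) x| ≤ C} := fun h => by
        have : x n ∈ (∅ : Set Ω) := hVe ▸ ⟨(hxm n).1, h⟩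
        exact this
    rw [mem_ofPred_eq] at h
    push Not at h
    exact h
  choose u w huw using hbad
  let β : (n : ℕ) → ContDiffBump ((x₀ : ℝ) + d n) := fun n =>
    ⟨d n / 8, d n / 4, by have := hd0 n; linarith, by have := hd0 n; linarith⟩
  have hU (v : CkSpace k Ω) (n : ℕ) :
      ContDiff ℝ k (fun y => β n y * extendByZero v.val y) :=
    (β n).contDiff_mul fun y hy => CkSpace.contDiffAt hΩ v ⟨y, (hmem n y hy).2⟩
  have hb (v : CkSpace k Ω) (n : ℕ) := (hU v n).exists_bound_iteratedFDeriv
    ((β n).hasCompactSupport.mul_right)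
  choose K hK0 hK using hb
  -- With parameters this small, every derivative of order at most k of the n-th hump is bounded by
  -- 2⁻ⁿ, so the humps sum to a C^k function.
  have hε (n : ℕ) : 0 < (1 / 2 : ℝ) ^ n / (K (u n) n + K (w n) n + 1) := by
    have := hK0 (u n) n
    have := hK0 (w n) n
    positivity
  choose s t hs ht hst using fun n => huw n _ (hε n) n
  let F : ℕ → ℝ → ℝ := fun n y =>
    s n * (β n y * extendByZero (u n).val y) + t n * (β n y * extendByZero (w n).val y)
  have hF (n) : ContDiff ℝ k (F n) :=
    (contDiff_const.mul (hU (u n) n)).add (contDiff_const.mul (hU (w n) n))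
  have hFb (j : ℕ) (n : ℕ) (y : ℝ) (hj : j ≤ k) : ‖iteratedFDeriv ℝ j (F n) y‖ ≤ (1 / 2) ^ n := by
    have hj' : (j : WithTop ℕ∞) ≤ k := by exact_mod_cast hj
    have hu' := ((hU (u n) n).of_le hj').contDiffAt (x := y)
    have hw' := ((hU (w n) n).of_le hj').contDiffAt (x := y)
    have h1 : iteratedFDeriv ℝ j (F n) y
        = s n • iteratedFDeriv ℝ j (fun y => β n y * extendByZero (u n).val y) y
          + t n • iteratedFDeriv ℝ j (fun y => β n y * extendByZero (w n).val y) y := by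
      rw [← iteratedFDeriv_const_smul_apply hu', ← iteratedFDeriv_const_smul_apply hw']
      exact iteratedFDeriv_add_apply (hu'.const_smul (s n)) (hw'.const_smul (t n))
    have h2 := hK (u n) n j hj y
    have h3 := hK (w n) n j hj y
    have h4 := hK0 (u n) n
    have h5 := hK0 (w n) n
    have h6 : (1 / 2 : ℝ) ^ n = (1 / 2 : ℝ) ^ n / (K (u n) n + K (w n) n + 1)
        * (K (u n) n + K (w n) n + 1) := by field_simp
    calc _ ≤ |s n| * K (u n) n + |t n| * K (w n) n := by
          rw [h1]
          refine (norm_add_le _ _).trans ?_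
          rw [norm_smul, norm_smul, Real.norm_eq_abs, Real.norm_eq_abs]
          gcongr
      _ ≤ (1 / 2 : ℝ) ^ n / (K (u n) n + K (w n) n + 1) * K (u n) n
          + (1 / 2 : ℝ) ^ n / (K (u n) n + K (w n) n + 1) * K (w n) n := by
          gcongr
          · exact (hs n).le
          · exact (ht n).le
      _ ≤ _ := by
          rw [← mul_add]
          conv_rhs => rw [h6]
          exact mul_le_mul_of_nonneg_left (by linarith) (hε n).le
  have hS : ContDiff ℝ k (fun y => ∑' n, F n y) := by
    refine contDiff_tsum (N := (k : ℕ∞)) (v := fun _ n => (1 / 2 : ℝ) ^ n) (fun n => hF n)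
      (fun _ _ => summable_geometric_two) fun j n y hj => hFb j n y (by exact_mod_cast hj)
  let f : CkSpace k Ω := CkSpace.ofContDiff Ω _ hS
  have hfn (n) : extendByZero f.val =ᶠ[𝓝 (x n : ℝ)]
      extendByZero (s n • u n + t n • w n : CkSpace k Ω).val := by
    filter_upwards [ball_mem_nhds ((x₀ : ℝ) + d n) (show 0 < d n / 8 by have := hd0 n; linarith)]
      with y hy
    have hyΩ : y ∈ Ω := (hmem n y (by
      rw [mem_closedBall]
      rw [mem_ball] at hy
      have := hd0 n
      linarith)).2
    rw [extendByZero_apply _ ⟨y, hyΩ⟩, extendByZero_apply _ ⟨y, hyΩ⟩]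
    change ∑' n, F n y = s n * (u n).val ⟨y, hyΩ⟩ + t n * (w n).val ⟨y, hyΩ⟩
    rw [tsum_eq_single n]
    · have h1 : β n y = 1 := (β n).one_of_mem_closedBall (ball_subset_closedBall hy)
      simp only [F, h1, one_mul]
      rw [extendByZero_apply _ ⟨y, hyΩ⟩, extendByZero_apply _ ⟨y, hyΩ⟩]
    · intro m hm
      have : β m y = 0 := by
        refine (β m).zero_of_le_dist ?_
        change d m / 4 ≤ _
        rw [mem_ball, Real.dist_eq, abs_lt] at hy
        rw [Real.dist_eq, le_abs]
        have := hd0 m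
        have := hd0 n
        rcases lt_or_gt_of_ne hm with h | h
        · have := hdlt h
          right
          linarith
        · have := hdlt h
          left
          linarith
      simp [F, this]
  have hlarge (n : ℕ) : (n : ℝ) < |T f (x n)| := by
    rw [hT f _ (x n) (hfn n)]
    exact hst n
  have hx : Tendsto x atTop (𝓝 x₀) := by
    rw [tendsto_subtype_rng]
    have : Tendsto d atTop (𝓝 (δ / 2 * 0)) :=
      (tendsto_pow_atTop_nhds_zero_of_lt_one (by norm_num) (by norm_num)).const_mul _
    simpa [x] using this.const_add (x₀ : ℝ)
  have h1 : Tendsto (fun n => |T f (x n)|) atTop (𝓝 |T f x₀|) :=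
    (((T f).continuous.tendsto x₀).comp hx).abs
  exact not_tendsto_nhds_of_tendsto_atTop
    (tendsto_atTop_mono (fun n => (hlarge n).le) tendsto_natCast_atTop_atTop) _ h1

/-! ### Flat functions -/

theorem ContDiff.iteratedDeriv_eq_zero_of_isLittleO {k : ℕ} {f : ℝ → ℝ} {x : ℝ}
    (hf : ContDiff ℝ k f) (ho : f =o[𝓝 x] fun y => (y - x) ^ k) :
    ∀ i ≤ k, iteratedDeriv i f x = 0 := by
  intro i
  induction i using Nat.strong_induction_on with
  | _ i ih =>
    intro hi
    have h1 : (fun y => (y - x) ^ k) =O[𝓝 x] fun y => (y - x) ^ i := by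
      obtain ⟨j, rfl⟩ := Nat.exists_eq_add_of_le hi
      have h2 : (fun y : ℝ => (y - x) ^ j) =O[𝓝 x] fun _ => (1 : ℝ) :=
        (Continuous.tendsto (by fun_prop) x).isBigO_one ℝ
      simpa [pow_add] using (isBigO_refl (fun y : ℝ => (y - x) ^ i) (𝓝 x)).mul h2
    have h2 := taylor_isLittleO_univ (x₀ := x) (n := i) (hf.of_le (by exact_mod_cast hi))
    have h3 := (ho.trans_isBigO h1).sub h2
    have h4 : ∀ y, f y - (f y - taylorWithinEval f i univ x y)
        = ((i.factorial : ℝ)⁻¹ * iteratedDeriv i f x) * (y - x) ^ i := by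
      intro y
      rw [sub_sub_cancel, taylor_within_apply, Finset.sum_range_succ, Finset.sum_eq_zero]
      · rw [iteratedDerivWithin_univ, smul_eq_mul]
        ring
      · intro j hj
        rw [Finset.mem_range] at hj
        rw [iteratedDerivWithin_univ, ih j hj (by omega), smul_zero]
    simp only [h4] at h3
    by_contra hne
    have hc : ((i.factorial : ℝ)⁻¹ * iteratedDeriv i f x) ≠ 0 :=
      mul_ne_zero (inv_ne_zero (by exact_mod_cast i.factorial_ne_zero)) hne
    rw [isLittleO_const_mul_left_iff hc] at h3
    have h5 : ∃ᶠ y in 𝓝 x, (y - x) ^ i ≠ 0 := by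
      have h6 : ∃ᶠ y in 𝓝[≠] x, y ≠ x := (eventually_mem_nhdsWithin (s := {x}ᶜ)).frequently
      exact (h6.filter_mono nhdsWithin_le_nhds).mono fun y hy => pow_ne_zero _ (sub_ne_zero.2 hy)
    exact isLittleO_irrefl h5 h3

/-- Differentiation commutes with the cut: at x itself the cut function is dominated by f, which is
o(y - x) there. Induction on k then applies to f'. -/
theorem ContDiff.indicator_Ioi {k : ℕ} {f : ℝ → ℝ} {x : ℝ} (hf : ContDiff ℝ k f)
    (h0 : ∀ i ≤ k, iteratedDeriv i f x = 0) : ContDiff ℝ k ((Ioi x).indicator f) := by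
  induction k generalizing f with
  | zero =>
    rw [Nat.cast_zero, contDiff_zero] at hf ⊢
    refine hf.indicator ?_
    intro a ha
    rw [frontier_Ioi, mem_singleton_iff] at ha
    simpa [ha] using h0 0 le_rfl
  | succ k ih =>
    have hf' := hf
    rw [Nat.cast_succ, contDiff_succ_iff_deriv] at hf ⊢
    have hd : ∀ y, HasDerivAt ((Ioi x).indicator f) ((Ioi x).indicator (deriv f) y) y := by
      intro y
      rcases lt_trichotomy y x with h | h | h
      · rw [indicator_of_notMem (by simpa using h.le)]
        refine (hasDerivAt_const y (0 : ℝ)).congr_of_eventuallyEq ?_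
        filter_upwards [Iio_mem_nhds h] with z hz
        exact indicator_of_notMem (by simpa using (le_of_lt hz)) _
      · subst h
        rw [indicator_of_notMem (by simp)]
        have h1 := (hf.1 y).hasDerivAt
        have h2 : f y = 0 := by simpa using h0 0 (by omega)
        have h3 : deriv f y = 0 := by simpa using h0 1 (by omega)
        rw [h3, hasDerivAt_iff_isLittleO] at h1
        rw [hasDerivAt_iff_isLittleO]
        refine (IsBigO.of_bound 1 (Eventually.of_forall fun z => ?_)).trans_isLittleO h1
        rw [indicator_of_notMem (show y ∉ Ioi y by simp), h2]
        simp only [sub_zero, smul_zero, one_mul]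
        exact norm_indicator_le_norm_self _ _
      · rw [indicator_of_mem (show y ∈ Ioi x from h)]
        refine (hf.1 y).hasDerivAt.congr_of_eventuallyEq ?_
        filter_upwards [Ioi_mem_nhds h] with z hz
        exact indicator_of_mem hz _
    refine ⟨fun y => (hd y).differentiableAt, by simp, ?_⟩
    rw [show deriv ((Ioi x).indicator f) = (Ioi x).indicator (deriv f) from
      funext fun y => (hd y).deriv]
    refine ih hf.2.2 fun i hi => ?_
    rw [← iteratedDeriv_succ']
    exact h0 (i + 1) (by omega)

theorem apply_eq_zero_of_eventually {Ω : Set ℝ} (hΩ : IsOpen Ω) (F : C(Ω, ℝ)) (x : Ω)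
    {l : Filter ℝ} [l.NeBot] (hl : l ≤ 𝓝 (x : ℝ)) (h : ∀ᶠ y in l, ∀ hy : y ∈ Ω, F ⟨y, hy⟩ = 0) :
    F x = 0 := by
  have hc : ContinuousAt (extendByZero F) x := by
    rw [← hΩ.isOpenEmbedding_subtypeVal.continuousAt_iff]
    have : extendByZero F ∘ Subtype.val = F := funext fun y => extendByZero_apply _ y
    rw [this]
    exact F.continuous.continuousAt
  have h1 : Tendsto (extendByZero F) l (𝓝 (extendByZero F x)) := hc.tendsto.mono_left hl
  have h2 : Tendsto (extendByZero F) l (𝓝 0) := by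
    refine tendsto_const_nhds.congr' ?_
    filter_upwards [h, hl (hΩ.mem_nhds x.2)] with y hy hyΩ
    rw [extendByZero_apply F ⟨y, hyΩ⟩, hy hyΩ]
  rw [extendByZero_apply] at h1
  exact tendsto_nhds_unique h1 h2

/-- Let ψ be φ to the right of x and 0 to the left; flatness makes it C^k. By locality A ψ is 0 on
the left and A φ on the right, and continuity at x identifies both limits with A ψ (x). -/
theorem IsLocalOperator.eq_zero_of_isLittleO {k : ℕ} {Ω : Set ℝ} (hΩ : IsOpen Ω)
    {A : CkSpace k Ω → C(Ω, ℝ)} (hA : IsLocalOperator A) (hA0 : A 0 = 0) (φ : CkSpace k Ω) (x : Ω)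
    (ho : extendByZero φ.val =o[𝓝 (x : ℝ)] fun y => (y - x) ^ k) : A φ x = 0 := by
  obtain ⟨G, hG, hGφ⟩ := exists_contDiff_eventuallyEq (CkSpace.contDiffAt hΩ φ x)
  have hI := hG.indicator_Ioi (hG.iteratedDeriv_eq_zero_of_isLittleO (ho.congr' hGφ.symm .rfl))
  let ψ : CkSpace k Ω := CkSpace.ofContDiff Ω _ hI
  have hψ (y : Ω) := CkSpace.extendByZero_ofContDiff hΩ y _ hI
  have hleft : A ψ x = 0 := by
    refine apply_eq_zero_of_eventually hΩ (A ψ) x (l := 𝓝[<] (x : ℝ)) nhdsWithin_le_nhds ?_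
    filter_upwards [self_mem_nhdsWithin] with y hy hyΩ
    rw [hA ψ 0 ⟨y, hyΩ⟩, hA0]
    · rfl
    · refine (hψ ⟨y, hyΩ⟩).trans ?_
      filter_upwards [Iio_mem_nhds (show y < x from hy), hΩ.mem_nhds hyΩ] with z hz hzΩ
      rw [indicator_of_notMem (by simpa using (le_of_lt hz)), extendByZero_apply _ ⟨z, hzΩ⟩]
      rfl
  have hright : (A ψ - A φ) x = 0 := by
    refine apply_eq_zero_of_eventually hΩ _ x (l := 𝓝[>] (x : ℝ)) nhdsWithin_le_nhds ?_
    filter_upwards [self_mem_nhdsWithin, nhdsWithin_le_nhds hGφ.eventually_nhds]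
      with y hy hGy hyΩ
    rw [ContinuousMap.sub_apply, sub_eq_zero]
    refine hA ψ φ ⟨y, hyΩ⟩ ((hψ ⟨y, hyΩ⟩).trans ?_)
    filter_upwards [Ioi_mem_nhds (show (x : ℝ) < y from hy), hGy] with z hz hGz
    rw [indicator_of_mem hz, hGz]
  rw [ContinuousMap.sub_apply, hleft] at hright
  linarith

/-! ### Additive local operators are linear -/

theorem AddMonoidHom.apply_eq_mul_of_bounded (a : ℝ →+ ℝ) {ε C : ℝ} (hε : 0 < ε)
    (h : ∀ s, |s| < ε → |a s| ≤ C) (c : ℝ) : a c = c * a 1 := by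
  have hC : 0 ≤ C := (abs_nonneg _).trans (h 0 (by simpa using hε))
  have h0 : ContinuousAt a 0 := by
    rw [Metric.continuousAt_iff]
    intro η hη
    obtain ⟨n, hn⟩ := exists_nat_gt (C / η)
    have hn0 : (0 : ℝ) < n := (div_nonneg hC hη.le).trans_lt hn
    refine ⟨ε / n, by positivity, fun {s} hs => ?_⟩
    rw [dist_zero_right, Real.norm_eq_abs, lt_div_iff₀ hn0] at hs
    have h1 := h (n * s) (by rw [abs_mul, Nat.abs_cast]; linarith)
    rw [← nsmul_eq_mul, map_nsmul, nsmul_eq_mul, abs_mul, Nat.abs_cast] at h1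
    rw [map_zero, dist_zero_right, Real.norm_eq_abs]
    rw [div_lt_iff₀ hη] at hn
    by_contra hcon
    push Not at hcon
    nlinarith
  have hc : Continuous a := continuous_of_continuousAt_zero a h0
  simpa using map_real_smul a hc c 1

/-- At a point of the dense set, s ↦ A(sφ)(x) is additive and bounded near 0, hence linear;
continuity of both sides extends the equality to Ω. -/
theorem IsLocalOperator.apply_smul {k : ℕ} {Ω : Set ℝ} (hΩ : IsOpen Ω)
    (A : CkSpace k Ω →+ C(Ω, ℝ)) (hA : IsLocalOperator A) (c : ℝ) (φ : CkSpace k Ω) :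
    A (c • φ) = c • A φ := by
  refine ContinuousMap.coe_injective ((hA.dense_bounded hΩ).induction ?_
    (isClosed_eq (A (c • φ)).continuous (c • A φ).continuous) |> funext)
  intro x hx
  obtain ⟨ε, hε, C, hC⟩ := hx φ 0
  let a : ℝ →+ ℝ :=
    { toFun := fun s => A (s • φ) x
      map_zero' := by simp
      map_add' := fun s t => by simp [add_smul] }
  have := a.apply_eq_mul_of_bounded hε (C := C)
    (fun s hs => by simpa [a] using hC s 0 hs (by simpa using hε)) c
  simpa [a] using this

/-! ### Exponential substitution -/

/-- The exponential of a `C^k` function. -/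
noncomputable def CkSpace.exp {k : ℕ} {Ω : Set ℝ} (φ : CkSpace k Ω) : CkSpace k Ω :=
  ⟨fun y => Real.exp (φ.val y), (ContDiffOn.exp φ.2).congr fun y hy => by
    rw [extendByZero_apply _ ⟨y, hy⟩, extendByZero_apply _ ⟨y, hy⟩]⟩

theorem CkSpace.exp_val {k : ℕ} {Ω : Set ℝ} (φ : CkSpace k Ω) (x : Ω) :
    (CkSpace.exp φ).val x = Real.exp (φ.val x) := rfl

theorem CkSpace.exp_add {k : ℕ} {Ω : Set ℝ} (φ ψ : CkSpace k Ω) :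
    CkSpace.exp (φ + ψ) = (CkSpace.exp φ) * (CkSpace.exp ψ) :=
  Subtype.ext (funext fun _ => Real.exp_add _ _)

/-- The operator `φ ↦ D(exp φ) / exp φ`. -/
noncomputable def logConjugate {k : ℕ} {Ω : Set ℝ} (D : CkSpace k Ω → C(Ω, ℝ)) (φ : CkSpace k Ω) : C(Ω, ℝ) :=
  ⟨fun x => D (CkSpace.exp φ) x * Real.exp (-φ.val x),
    (D (CkSpace.exp φ)).continuous.mul (Real.continuous_exp.comp (CkSpace.continuous φ).neg)⟩

theorem logConjugate_apply {k : ℕ} {Ω : Set ℝ} (D : CkSpace k Ω → C(Ω, ℝ)) (φ : CkSpace k Ω)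
    (x : Ω) : logConjugate D φ x = D (CkSpace.exp φ) x * Real.exp (-φ.val x) := rfl

theorem apply_exp_eq {k : ℕ} {Ω : Set ℝ} (D : CkSpace k Ω → C(Ω, ℝ)) (φ : CkSpace k Ω)
    (x : Ω) : D (CkSpace.exp φ) x = Real.exp (φ.val x) * logConjugate D φ x := by
  rw [logConjugate_apply, Real.exp_neg]
  field_simp

theorem ThreeVariableIdentity.logConjugate_add {k : ℕ} {Ω : Set ℝ} {D : CkSpace k Ω → C(Ω, ℝ)}
    (hD : ThreeVariableIdentity D) (φ ψ χ : CkSpace k Ω) :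
    logConjugate D (φ + ψ + χ) = logConjugate D (φ + ψ) + logConjugate D (φ + χ)
      + logConjugate D (ψ + χ) - logConjugate D φ - logConjugate D ψ - logConjugate D χ := by
  ext x
  have h := hD (CkSpace.exp φ) (CkSpace.exp ψ) (CkSpace.exp χ) x
  simp only [← CkSpace.exp_add, apply_exp_eq, CkSpace.exp_val] at h
  have e (f g : CkSpace k Ω) : (f + g).val x = f.val x + g.val x := rfl
  simp only [e, Real.exp_add] at h
  simp only [ContinuousMap.add_apply, ContinuousMap.sub_apply]
  have h1 := (Real.exp_pos (φ.val x)).ne'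
  have h2 := (Real.exp_pos (ψ.val x)).ne'
  have h3 := (Real.exp_pos (χ.val x)).ne'
  rw [← sub_eq_zero]
  refine (mul_eq_zero.1 ?_).resolve_left (mul_ne_zero (mul_ne_zero h1 h2) h3)
  linear_combination h

theorem IsLocalOperator.logConjugate {k : ℕ} {Ω : Set ℝ} {D : CkSpace k Ω → C(Ω, ℝ)}
    (hD : IsLocalOperator D) : IsLocalOperator (logConjugate D) := by
  intro φ ψ x h
  rw [logConjugate_apply, logConjugate_apply]
  have h1 : φ.val x = ψ.val x := by simpa [extendByZero_apply] using h.eq_of_nhds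
  rw [h1, hD (CkSpace.exp φ) (CkSpace.exp ψ) x]
  have e (f : CkSpace k Ω) : extendByZero (CkSpace.exp f).val =
      Ω.indicator (fun y => Real.exp (extendByZero f.val y)) := by
    funext y
    by_cases hy : y ∈ Ω
    · rw [indicator_of_mem hy, extendByZero_apply _ ⟨y, hy⟩, extendByZero_apply _ ⟨y, hy⟩]
      rfl
    · rw [indicator_of_notMem hy]
      exact Function.extend_apply' _ _ _ fun ⟨a, ha⟩ => hy (ha ▸ a.2)
  rw [e, e]
  filter_upwards [h] with y hy
  simp only [indicator, hy]

/-- Polarization: B is half the second difference of G, biadditive because the third difference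
vanishes, and A = G - B(φ, φ) is then additive. Both inherit locality from G, which upgrades
additivity to linearity. -/
theorem ThreeVariableIdentity.exists_linear_bilinear {k : ℕ} {Ω : Set ℝ} (hΩ : IsOpen Ω)
    {D : CkSpace k Ω → C(Ω, ℝ)} (hD : ThreeVariableIdentity D) :
    ∃ (A : CkSpace k Ω →ₗ[ℝ] C(Ω, ℝ)) (B : CkSpace k Ω →ₗ[ℝ] CkSpace k Ω →ₗ[ℝ] C(Ω, ℝ)),
      IsLocalOperator A ∧ (∀ φ, IsLocalOperator (B φ)) ∧ (∀ φ ψ, B φ ψ = B ψ φ) ∧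
      ∀ φ x, D (CkSpace.exp φ) x = Real.exp (φ.val x) * (A φ x + B φ φ x) := by
  have hG := (hD.isLocalOperator).logConjugate
  have hadd := hD.logConjugate_add
  have hexp := apply_exp_eq D
  generalize logConjugate D = G at hG hadd hexp
  let b (φ ψ : CkSpace k Ω) : C(Ω, ℝ) := (2⁻¹ : ℝ) • (G (φ + ψ) - G φ - G ψ)
  have bcomm (φ ψ) : b φ ψ = b ψ φ := by
    simp only [b, add_comm ψ φ]
    congr 1
    abel
  have badd (φ ψ χ) : b φ (ψ + χ) = b φ ψ + b φ χ := by
    simp only [b, ← add_assoc, hadd, ← smul_add]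
    congr 1
    abel
  have hbloc (φ) : IsLocalOperator (b φ) := by
    intro f g x h
    have h1 := hG f g x h
    have h2 := hG (φ + f) (φ + g) x (by
      change extendByZero (φ.val + f.val) =ᶠ[_] extendByZero (φ.val + g.val)
      rw [extendByZero_add, extendByZero_add]
      exact h.mono fun y hy => by simp only [Pi.add_apply, hy])
    simp only [b, ContinuousMap.smul_apply, ContinuousMap.sub_apply, h1, h2]
  let b' (φ) : CkSpace k Ω →+ C(Ω, ℝ) := AddMonoidHom.mk' (b φ) (badd φ)
  have bsmul (c : ℝ) (φ ψ) : b φ (c • ψ) = c • b φ ψ :=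
    IsLocalOperator.apply_smul hΩ (b' φ) (hbloc φ) c ψ
  let a (φ : CkSpace k Ω) : C(Ω, ℝ) := G φ - b φ φ
  have aadd (φ ψ) : a (φ + ψ) = a φ + a ψ := by
    have h1 : G (φ + ψ) = (2 : ℝ) • b φ ψ + G φ + G ψ := by
      simp only [b, smul_inv_smul₀ (two_ne_zero (α := ℝ))]
      abel
    simp only [a]
    rw [badd, bcomm (φ + ψ) φ, bcomm (φ + ψ) ψ, badd, badd, bcomm ψ φ, h1, two_smul]
    abel
  have aloc : IsLocalOperator a := by
    intro f g x h
    have h1 := hG f g x h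
    have h2 := hbloc f f g x h
    have h3 := hbloc g f g x h
    simp only [a, ContinuousMap.sub_apply, h1, h2]
    rw [bcomm f g, h3]
  refine ⟨⟨⟨a, aadd⟩, IsLocalOperator.apply_smul hΩ (AddMonoidHom.mk' a aadd) aloc⟩,
    LinearMap.mk₂ ℝ b (fun φ ψ χ => ?_) (fun c φ ψ => ?_) badd bsmul, aloc, hbloc, bcomm, ?_⟩
  · rw [bcomm, badd, bcomm χ φ, bcomm χ ψ]
  · rw [bcomm, bsmul, bcomm]
  · intro φ x
    rw [hexp]
    congr 1
    change G φ x = (a φ + b φ φ) x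
    simp [a]

/-! ### Growth of polynomials against logarithms -/

theorem Polynomial.natDegree_le_one_of_isLittleO {p : Polynomial ℝ}
    (h : (fun M => p.eval M) =o[atTop] fun M : ℝ => M ^ 2) : p.natDegree ≤ 1 := by
  by_contra hd
  push Not at hd
  have hp : p ≠ 0 := by
    rintro rfl
    simp at hd
  have h1 : (fun M : ℝ => M ^ 2) =O[atTop] fun M => p.eval M := by
    have := Polynomial.isBigO_atTop_of_degree_le (P := (Polynomial.X ^ 2 : Polynomial ℝ)) (Q := p) (by
      rw [Polynomial.degree_X_pow, Polynomial.degree_eq_natDegree hp]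
      exact_mod_cast hd)
    simpa using this
  have h2 := h1.trans_isLittleO h
  refine isLittleO_irrefl ?_ h2
  exact ((eventually_gt_atTop 0).mono fun M hM => (pow_pos hM 2).ne').frequently

/-- Boundedness near the origin forces `2 log s q(M) + r(M)` to be linear in `M`. -/
theorem Polynomial.eval_eq_of_bounded {q r : Polynomial ℝ} {a a₀ b₀ ε C : ℝ} (hε : 0 < ε)
    (hq : ∃ q', q = Polynomial.X * q')
    (hr : ∃ r', r = Polynomial.X * (Polynomial.C a + Polynomial.X * r'))
    (h : ∀ s M : ℝ, 0 < s → s < ε → |s * M| < ε →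
      |s * (a₀ * Real.log s + b₀ * Real.log s ^ 2 + 2 * Real.log s * q.eval M + r.eval M)| ≤ C) :
    (∀ M, q.eval M = 0) ∧ ∀ M, r.eval M = a * M := by
  -- The curve s = δ/M, M → ∞, keeps sM = δ fixed, so the bracket is O(M).
  have key (δ : ℝ) (hδ : 0 < δ) (hδε : δ < ε) :
      (fun M : ℝ => a₀ * (Real.log δ - Real.log M) + b₀ * (Real.log δ - Real.log M) ^ 2
        + 2 * (Real.log δ - Real.log M) * q.eval M + r.eval M) =O[atTop] fun M => M := by
    refine IsBigO.of_bound (C / δ) ?_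
    filter_upwards [eventually_ge_atTop 1] with M hM
    have hM0 : 0 < M := by linarith
    have h1 := h (δ / M) M (by positivity) ((div_le_self hδ.le hM).trans_lt hδε)
      (by rw [div_mul_cancel₀ _ hM0.ne', abs_of_pos hδ]; exact hδε)
    rw [Real.log_div hδ.ne' hM0.ne', abs_mul, abs_of_pos (div_pos hδ hM0)] at h1
    rw [Real.norm_eq_abs, Real.norm_eq_abs, abs_of_pos hM0]
    rw [div_mul_eq_mul_div, div_le_iff₀ hM0] at h1
    rw [div_mul_eq_mul_div, le_div_iff₀ hδ]
    linarith
  have hc (c : ℝ) : (fun _ : ℝ => c) =o[atTop] fun M : ℝ => M := isLittleO_const_id_atTop c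
  have hlog : Real.log =o[atTop] fun M : ℝ => M := Real.isLittleO_log_id_atTop
  have hL (c : ℝ) : (fun M : ℝ => c - Real.log M) =o[atTop] fun M : ℝ => M := (hc c).sub hlog
  have hL2 (c : ℝ) : (fun M : ℝ => (c - Real.log M) ^ 2) =o[atTop] fun M : ℝ => M := by
    have h1 : (fun M : ℝ => Real.log M ^ 2) =o[atTop] fun M : ℝ => M :=
      Real.isLittleO_pow_log_id_atTop
    refine (((hc (c ^ 2)).sub (hlog.const_mul_left (2 * c))).add h1).congr_left fun M => ?_
    ring
  have hid2 : (fun M : ℝ => M) =o[atTop] fun M : ℝ => M ^ 2 := by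
    simpa using isLittleO_pow_pow_atTop_of_lt (𝕜 := ℝ) (show 1 < 2 by norm_num)
  have hlog2 : Real.log 2 ≠ 0 := (Real.log_pos (by norm_num)).ne'
  -- Subtracting the bounds for two values of δ with ratio 2 cancels r and leaves 2 log 2 · q(M) up
  -- to O(M). Hence q = cM.
  have hqO : (fun M => q.eval M) =O[atTop] fun M : ℝ => M := by
    have h1 := (key (ε / 2) (by positivity) (by linarith)).sub
      (key (ε / 2 / 2) (by positivity) (by linarith))
    have h2 := (((hc (a₀ * Real.log 2 - b₀ * Real.log 2 ^ 2)).add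
      ((hL (Real.log (ε / 2))).const_mul_left (2 * b₀ * Real.log 2))).isBigO)
    refine ((h1.sub h2).const_mul_left (2 * Real.log 2)⁻¹).congr_left fun M => ?_
    rw [Real.log_div (by positivity : ε / 2 ≠ 0) two_ne_zero]
    field_simp
    ring
  obtain ⟨q', rfl⟩ := hq
  obtain ⟨c, rfl⟩ : ∃ c, q' = Polynomial.C c := by
    have h1 := Polynomial.natDegree_le_one_of_isLittleO (hqO.trans_isLittleO hid2)
    refine ⟨q'.coeff 0, Polynomial.eq_C_of_natDegree_eq_zero ?_⟩
    by_contra hne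
    have : q' ≠ 0 := by
      rintro rfl
      simp at hne
    rw [Polynomial.natDegree_X_mul this] at h1
    omega
  have hk := key (ε / 2) (by positivity) (by linarith)
  set l := Real.log (ε / 2)
  have hrlin : ∀ M, r.eval M = a * M := by
    have h1 : (fun M => r.eval M) =o[atTop] fun M : ℝ => M ^ 2 := by
      have h2 := ((hL l).mul_isBigO (isBigO_refl (fun M : ℝ => M) atTop)).const_mul_left (2 * c)
      have h3 := ((hL l).const_mul_left a₀).isBigO.add ((hL2 l).const_mul_left b₀).isBigO
      refine (((hk.sub h3).trans_isLittleO hid2).sub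
        (h2.congr_right fun M => by ring)).congr_left fun M => ?_
      simp only [Polynomial.eval_mul, Polynomial.eval_X, Polynomial.eval_C]
      ring
    have h2 := Polynomial.natDegree_le_one_of_isLittleO h1
    obtain ⟨r', rfl⟩ := hr
    have : r' = 0 := by
      by_contra hne
      have h3 : (Polynomial.C a + Polynomial.X * r') ≠ 0 := by
        intro h0
        have h4 : (Polynomial.X * r').natDegree = 0 := by
          rw [eq_neg_of_add_eq_zero_right h0, ← Polynomial.C_neg, Polynomial.natDegree_C]
        rw [Polynomial.natDegree_X_mul hne] at h4
        omega
      rw [Polynomial.natDegree_X_mul h3, add_comm (Polynomial.C a), Polynomial.natDegree_add_C,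
        Polynomial.natDegree_X_mul hne] at h2
      omega
    intro M
    rw [this, mul_zero, add_zero, Polynomial.eval_mul, Polynomial.eval_X, Polynomial.eval_C,
      mul_comm]
  refine ⟨?_, hrlin⟩
  -- With r linear, c ≠ 0 would leave M log M = O(M).
  suffices c = 0 by simp [this]
  by_contra hc0
  have h1 : (fun M : ℝ => (l - Real.log M) * M) =O[atTop] fun M : ℝ => 1 * M := by
    have h3 := (((hL l).const_mul_left a₀).isBigO.add ((hL2 l).const_mul_left b₀).isBigO).add
      ((isBigO_refl (fun M : ℝ => M) atTop).const_mul_left a)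
    refine ((hk.sub h3).const_mul_left (2 * c)⁻¹).congr (fun M => ?_) fun M => (one_mul M).symm
    rw [hrlin]
    simp only [Polynomial.eval_mul, Polynomial.eval_X, Polynomial.eval_C]
    field_simp
    ring
  have h2 : (fun M : ℝ => l - Real.log M) =O[atTop] fun _ : ℝ => (1 : ℝ) := by
    have hinv : (fun M : ℝ => M⁻¹) =O[atTop] fun M : ℝ => M⁻¹ := isBigO_refl _ _
    refine (h1.mul hinv).congr' ?_ ?_
    · filter_upwards [eventually_gt_atTop 0] with M hM
      field_simp
    · filter_upwards [eventually_gt_atTop 0] with M hM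
      field_simp
  have h3 : Tendsto (fun M : ℝ => l - Real.log M) atTop atBot :=
    tendsto_atBot_add_const_left _ l (tendsto_neg_atTop_atBot.comp Real.tendsto_log_atTop)
  have h4 : Tendsto (fun M : ℝ => ‖l - Real.log M‖) atTop atTop := tendsto_abs_atBot_atTop.comp h3
  rw [isBigO_one_iff] at h2
  exact not_isBoundedUnder_of_tendsto_atTop h4 h2

/-! ### The deformation s(1 - Mv) and positive values -/

theorem exists_polynomial_eval_sum {V : Type*} [AddCommGroup V] [Module ℝ V] (α : V →ₗ[ℝ] ℝ)
    (w : ℕ → V) (n : ℕ) :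
    ∃ p : Polynomial ℝ, ∀ M : ℝ, α (∑ i ∈ Finset.range n, M ^ i • w i) = p.eval M := by
  refine ⟨∑ i ∈ Finset.range n, Polynomial.C (α (w i)) * Polynomial.X ^ i, fun M => ?_⟩
  simp only [map_sum, map_smul, smul_eq_mul, Polynomial.eval_finsetSum, Polynomial.eval_mul,
    Polynomial.eval_C, Polynomial.eval_pow, Polynomial.eval_X, mul_comm]

/-- The factored form records that the constant term is 0 and that the linear coefficient involves α
alone; this is what survives the growth argument. -/
theorem exists_polynomial_eval {V : Type*} [AddCommGroup V] [Module ℝ V] (α : V →ₗ[ℝ] ℝ)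
    (β : V →ₗ[ℝ] V →ₗ[ℝ] ℝ) (v : V) (w : ℕ → V) (n : ℕ) :
    ∃ r : Polynomial ℝ, ∀ M : ℝ,
      α (M • v + M ^ 2 • ∑ i ∈ Finset.range n, M ^ i • w i)
        + β (M • v + M ^ 2 • ∑ i ∈ Finset.range n, M ^ i • w i)
          (M • v + M ^ 2 • ∑ i ∈ Finset.range n, M ^ i • w i)
      = (Polynomial.X * (Polynomial.C (α v) + Polynomial.X * r)).eval M := by
  obtain ⟨p₁, h₁⟩ := exists_polynomial_eval_sum α w n
  obtain ⟨p₂, h₂⟩ := exists_polynomial_eval_sum (β v) w n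
  obtain ⟨p₃, h₃⟩ := exists_polynomial_eval_sum (β.flip v) w n
  choose p₄ h₄ using fun i => exists_polynomial_eval_sum (β (w i)) w n
  have h₅ (M : ℝ) : β (∑ i ∈ Finset.range n, M ^ i • w i) (∑ i ∈ Finset.range n, M ^ i • w i)
      = (∑ i ∈ Finset.range n, Polynomial.X ^ i * p₄ i).eval M := by
    conv_lhs => enter [1]; rw [map_sum]
    simp only [map_smul, LinearMap.sum_apply, LinearMap.smul_apply, smul_eq_mul, h₄,
      Polynomial.eval_finsetSum, Polynomial.eval_mul, Polynomial.eval_pow, Polynomial.eval_X]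
  refine ⟨p₁ + Polynomial.C (β v v) + Polynomial.X * p₂ + Polynomial.X * p₃
    + Polynomial.X ^ 2 * ∑ i ∈ Finset.range n, Polynomial.X ^ i * p₄ i, fun M => ?_⟩
  have h₃' := h₃ M
  rw [LinearMap.flip_apply] at h₃'
  simp only [Polynomial.eval_add, Polynomial.eval_mul, Polynomial.eval_X, Polynomial.eval_C,
    Polynomial.eval_pow, ← h₁, ← h₂, ← h₃', ← h₅]
  generalize ∑ i ∈ Finset.range n, M ^ i • w i = S
  simp only [map_add, map_smul, LinearMap.add_apply, LinearMap.smul_apply, smul_eq_mul]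
  ring

/-- For k ≥ 1, v = O(y - x) by differentiability, so k factors give the rate; for k = 0 that rate is
trivial. The last factor tends to 0. -/
theorem CkSpace.pow_isLittleO {k : ℕ} {Ω : Set ℝ} (hΩ : IsOpen Ω) (v : CkSpace k Ω) (x : Ω)
    (hv : v.val x = 0) :
    (fun y => extendByZero v.val y ^ (k + 1)) =o[𝓝 (x : ℝ)] fun y => (y - x) ^ k := by
  have hc := CkSpace.contDiffAt hΩ v x
  have h0 : extendByZero v.val x = 0 := by rw [extendByZero_apply, hv]
  have h1 : extendByZero v.val =o[𝓝 (x : ℝ)] fun _ => (1 : ℝ) := by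
    rw [isLittleO_one_iff, ← h0]
    exact hc.continuousAt
  have h2 : (fun y => extendByZero v.val y ^ k) =O[𝓝 (x : ℝ)] fun y => (y - x) ^ k := by
    rcases Nat.eq_zero_or_pos k with rfl | hk
    · simpa using isBigO_refl (fun _ : ℝ => (1 : ℝ)) _
    · have h3 := (hc.differentiableAt (by simp; omega)).isBigO_sub
      rw [h0] at h3
      simpa using h3.pow k
  simpa [pow_succ] using h2.mul_isLittleO h1

/-- The Taylor polynomial of `log(1 - M v)` in `M`. -/
theorem CkSpace.log_sub_isLittleO {k : ℕ} {Ω : Set ℝ} (hΩ : IsOpen Ω) (v ℓ : CkSpace k Ω) (x : Ω)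
    (hv : v.val x = 0) {s : ℝ} (hs : 0 < s) (M : ℝ)
    (hℓ : extendByZero ℓ.val =ᶠ[𝓝 (x : ℝ)]
      fun y => Real.log (extendByZero (s • 1 + (-(s * M)) • v : CkSpace k Ω).val y)) :
    extendByZero (ℓ - (Real.log s • 1 + (M • (-v)
      + M ^ 2 • ∑ i ∈ Finset.range k, M ^ i • (-(1 / ((i : ℝ) + 2)) • v ^ (i + 2)))) :
        CkSpace k Ω).val =o[𝓝 (x : ℝ)] fun y => (y - x) ^ k := by
  have hc := (CkSpace.contDiffAt hΩ v x).continuousAt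
  have h0 : extendByZero v.val x = 0 := by rw [extendByZero_apply, hv]
  have hsmall : ∀ᶠ y in 𝓝 (x : ℝ), |M * extendByZero v.val y| < 1 / 2 := by
    have h1 : Tendsto (fun y => |M * extendByZero v.val y|) (𝓝 (x : ℝ)) (𝓝 0) := by
      have := (hc.tendsto.const_mul M).abs
      simpa [h0] using this
    exact h1.eventually_lt_const (by norm_num)
  -- The polynomial has degree k + 1 in M, so its linear term is present even for k = 0. The
  -- remainder is of order k + 2: the 2 bounds 1/(1 - |Mv|), and the surplus factor |v| < 1 is
  -- dropped.
  refine (IsBigO.of_bound (2 * |M| ^ (k + 2)) ?_).trans_isLittleO (CkSpace.pow_isLittleO hΩ v x hv)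
  have hv1 : ∀ᶠ y in 𝓝 (x : ℝ), |extendByZero v.val y| < 1 := by
    have h1 : Tendsto (fun y => |extendByZero v.val y|) (𝓝 (x : ℝ)) (𝓝 0) := by
      simpa [h0] using hc.tendsto.abs
    exact h1.eventually_lt_const (by norm_num)
  filter_upwards [hℓ, hsmall, hv1, hΩ.mem_nhds x.2] with y hy hMy hvy hyΩ
  rw [extendByZero_apply _ ⟨y, hyΩ⟩, extendByZero_apply _ ⟨y, hyΩ⟩] at hy
  rw [extendByZero_apply _ ⟨y, hyΩ⟩] at hMy hvy
  rw [extendByZero_apply _ ⟨y, hyΩ⟩, extendByZero_apply _ ⟨y, hyΩ⟩]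
  set t := v.val ⟨y, hyΩ⟩ with ht
  have e1 : (s • 1 + (-(s * M)) • v : CkSpace k Ω).val ⟨y, hyΩ⟩ = s * (1 - M * t) := by
    change s * 1 + (-(s * M)) * t = _
    ring
  have e2 : (ℓ - (Real.log s • 1 + (M • (-v)
      + M ^ 2 • ∑ i ∈ Finset.range k, M ^ i • (-(1 / ((i : ℝ) + 2)) • v ^ (i + 2)))) :
        CkSpace k Ω).val ⟨y, hyΩ⟩ = ℓ.val ⟨y, hyΩ⟩ - Real.log s
        + ∑ i ∈ Finset.range (k + 1), (M * t) ^ (i + 1) / (i + 1) := by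
    rw [Finset.sum_range_succ']
    have e3 : (∑ i ∈ Finset.range k, M ^ i • (-(1 / ((i : ℝ) + 2)) • v ^ (i + 2)) :
        CkSpace k Ω).val ⟨y, hyΩ⟩
        = ∑ i ∈ Finset.range k, M ^ i * (-(1 / ((i : ℝ) + 2)) * t ^ (i + 2)) := by
      rw [AddSubmonoidClass.coe_finsetSum, Finset.sum_apply]
      rfl
    change ℓ.val ⟨y, hyΩ⟩ - (Real.log s * 1 + (M * (-t) + M ^ 2 * (_ : CkSpace k Ω).val ⟨y, hyΩ⟩)) = _
    rw [e3, Finset.mul_sum]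
    have e4 : ∑ i ∈ Finset.range k, M ^ 2 * (M ^ i * (-(1 / ((i : ℝ) + 2)) * t ^ (i + 2)))
      = -∑ i ∈ Finset.range k, (M * t) ^ (i + 1 + 1) / (((i + 1 : ℕ) : ℝ) + 1) := by
      rw [← Finset.sum_neg_distrib]
      refine Finset.sum_congr rfl fun i _ => ?_
      push_cast
      rw [show (i : ℝ) + 1 + 1 = i + 2 by ring]
      ring
    rw [e4]
    push_cast
    ring
  rw [e2, hy, e1, Real.log_mul hs.ne' (by linarith [abs_lt.1 hMy])]
  have h3 := Real.abs_log_sub_add_sum_range_le (show |M * t| < 1 by linarith) (k + 1)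
  rw [Real.norm_eq_abs, Real.norm_eq_abs]
  calc _ = |(∑ i ∈ Finset.range (k + 1), (M * t) ^ (i + 1) / (i + 1)) + Real.log (1 - M * t)| := by
        congr 1
        ring
    _ ≤ |M * t| ^ (k + 1 + 1) / (1 - |M * t|) := h3
    _ ≤ |M * t| ^ (k + 1 + 1) / (1 / 2) := by
        gcongr
        linarith
    _ = 2 * |M| ^ (k + 2) * (|t| ^ (k + 1) * |t|) := by
        rw [abs_mul, mul_pow, ← pow_succ]
        ring
    _ ≤ 2 * |M| ^ (k + 2) * (|t| ^ (k + 1) * 1) := by gcongr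
    _ = _ := by rw [mul_one, abs_pow]

theorem IsLocalOperator.apply_eq_of_pos {k : ℕ} {Ω : Set ℝ} (hΩ : IsOpen Ω)
    {D : CkSpace k Ω → C(Ω, ℝ)} (hD : IsLocalOperator D)
    {A : CkSpace k Ω →ₗ[ℝ] C(Ω, ℝ)} {B : CkSpace k Ω →ₗ[ℝ] CkSpace k Ω →ₗ[ℝ] C(Ω, ℝ)}
    (hA : IsLocalOperator A) (hB : ∀ φ, IsLocalOperator (B φ)) (hsymm : ∀ φ ψ, B φ ψ = B ψ φ)
    (hexp : ∀ φ x, D (CkSpace.exp φ) x = Real.exp (φ.val x) * (A φ x + B φ φ x)) (x : Ω)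
    (hx : ∀ u w : CkSpace k Ω, ∃ ε > 0, ∃ C, ∀ s t : ℝ, |s| < ε → |t| < ε →
      |D (s • u + t • w) x| ≤ C) (f : CkSpace k Ω) (hf : 0 < f.val x) :
    D f x = A 1 x * f.val x * Real.log (f.val x) + B 1 1 x * f.val x * Real.log (f.val x) ^ 2
      + (A f x - f.val x * A 1 x) := by
  let ev : C(Ω, ℝ) →ₗ[ℝ] ℝ := LinearMap.proj x ∘ₗ ContinuousMap.coeFnLinearMap ℝ
  let α := ev ∘ₗ A
  let β := B.compr₂ ev
  have hα (φ : CkSpace k Ω) (h : extendByZero φ.val =o[𝓝 (x : ℝ)] fun y => (y - x) ^ k) :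
      α φ = 0 := hA.eq_zero_of_isLittleO hΩ (map_zero A) φ x h
  have hβ (ψ φ : CkSpace k Ω) (h : extendByZero φ.val =o[𝓝 (x : ℝ)] fun y => (y - x) ^ k) :
      β ψ φ = 0 := (hB ψ).eq_zero_of_isLittleO hΩ (map_zero (B ψ)) φ x h
  have hβs (φ ψ : CkSpace k Ω) : β φ ψ = β ψ φ := by
    change (B φ ψ) x = (B ψ φ) x
    rw [hsymm]
  set v : CkSpace k Ω := 1 - (f.val x)⁻¹ • f with hvdef
  have hv : v.val x = 0 := by
    change 1 - (f.val x)⁻¹ * f.val x = 0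
    rw [inv_mul_cancel₀ hf.ne', sub_self]
  set w : ℕ → CkSpace k Ω := fun i => -(1 / ((i : ℝ) + 2)) • v ^ (i + 2) with hw
  let P (M : ℝ) : CkSpace k Ω := M • (-v) + M ^ 2 • ∑ i ∈ Finset.range k, M ^ i • w i
  obtain ⟨r, hr⟩ := exists_polynomial_eval α β (-v) w k
  -- The cross term 2 log s · B(1, P(M)) is linear in P(M), so the bilinear form is taken to be 0.
  obtain ⟨q, hq⟩ := exists_polynomial_eval (β 1) 0 (-v) w k
  simp only [LinearMap.zero_apply, add_zero] at hq
  have main (s M : ℝ) (hs : 0 < s) : D (s • 1 + (-(s * M)) • v) x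
      = s * (α 1 * Real.log s + β 1 1 * Real.log s ^ 2
        + 2 * Real.log s * (Polynomial.X * (Polynomial.C (β 1 (-v)) + Polynomial.X * q)).eval M
        + (Polynomial.X * (Polynomial.C (α (-v)) + Polynomial.X * r)).eval M) := by
    set g : CkSpace k Ω := s • 1 + (-(s * M)) • v with hg
    have hgx : g.val x = s := by
      change s * 1 + (-(s * M)) * v.val x = s
      rw [hv]
      ring
    obtain ⟨ℓ, hℓ⟩ := CkSpace.exists_eventuallyEq hΩ x
      ((CkSpace.contDiffAt hΩ g x).log (by rw [extendByZero_apply, hgx]; exact hs.ne'))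
    have hflat := CkSpace.log_sub_isLittleO hΩ v ℓ x hv hs M hℓ
    have hℓx : ℓ.val x = Real.log s := by
      have := hℓ.eq_of_nhds
      rwa [extendByZero_apply, extendByZero_apply, hgx] at this
    have hgℓ : D g x = D (CkSpace.exp ℓ) x := by
      refine hD _ _ x ?_
      have hpos : ∀ᶠ y in 𝓝 (x : ℝ), 0 < extendByZero g.val y := by
        refine (CkSpace.contDiffAt hΩ g x).continuousAt.eventually_const_lt ?_
        rw [extendByZero_apply, hgx]
        exact hs
      filter_upwards [hℓ, hpos, hΩ.mem_nhds x.2] with y hy hpy hyΩ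
      rw [extendByZero_apply (CkSpace.exp ℓ).val ⟨y, hyΩ⟩, CkSpace.exp_val,
        ← extendByZero_apply ℓ.val ⟨y, hyΩ⟩, hy, Real.exp_log hpy]
    change extendByZero (ℓ - (Real.log s • 1 + P M)).val =o[_] _ at hflat
    have h1 : α ℓ = α (Real.log s • 1 + P M) := by
      rw [← sub_eq_zero, ← map_sub, hα _ hflat]
    have h2 (ψ) : β ψ ℓ = β ψ (Real.log s • 1 + P M) := by
      rw [← sub_eq_zero, ← map_sub, hβ _ _ hflat]
    have h3 : D g x = s * (α ℓ + β ℓ ℓ) := by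
      rw [hgℓ, hexp, hℓx, Real.exp_log hs]
      rfl
    rw [h3, h2, hβs, h2, h1, ← hr, ← hq]
    change _ = s * (α 1 * Real.log s + β 1 1 * Real.log s ^ 2 + 2 * Real.log s * β 1 (P M)
      + (α (P M) + β (P M) (P M)))
    simp only [map_add, map_smul, LinearMap.add_apply, LinearMap.smul_apply, smul_eq_mul]
    rw [hβs (P M) 1]
    ring
  obtain ⟨ε, hε, C, hC⟩ := hx 1 v
  obtain ⟨hq0, hr0⟩ := Polynomial.eval_eq_of_bounded hε ⟨_, rfl⟩ ⟨r, rfl⟩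
    (a₀ := α 1) (b₀ := β 1 1) (C := C) (a := α (-v))
    (q := Polynomial.X * (Polynomial.C (β 1 (-v)) + Polynomial.X * q)) fun s M hs hsε hsM => by
      rw [← main s M hs]
      exact hC s _ (by rwa [abs_of_pos hs]) (by rwa [abs_neg])
  -- The parameters s = f(x), M = 1 recover f itself.
  have h1 := main (f.val x) 1 hf
  rw [hq0, hr0] at h1
  have hfe : f.val x • 1 + (-(f.val x * 1)) • v = f := by
    rw [hvdef, mul_one, neg_smul, smul_sub, smul_smul, mul_inv_cancel₀ hf.ne', one_smul]
    abel
  rw [hfe, hvdef] at h1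
  simp only [map_neg, map_sub, map_smul, smul_eq_mul] at h1
  rw [h1]
  change _ = α 1 * _ * _ + β 1 1 * _ * _ + (α f - _ * α 1)
  field_simp
  ring

/-! ### The linear part as a differential operator -/

/-- The coordinate function on `Ω`. -/
def CkSpace.id (k : ℕ) (Ω : Set ℝ) : CkSpace k Ω := CkSpace.ofContDiff Ω _root_.id contDiff_id

/-- The function `y ↦ y - x` on `Ω`. -/
noncomputable def CkSpace.centered {k : ℕ} {Ω : Set ℝ} (x : Ω) : CkSpace k Ω :=
  CkSpace.id k Ω - (x : ℝ) • 1

theorem CkSpace.centered_val {k : ℕ} {Ω : Set ℝ} (x y : Ω) :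
    (CkSpace.centered x : CkSpace k Ω).val y = y - x := by
  change (y : ℝ) - x * 1 = _
  rw [mul_one]

theorem CkSpace.centered_pow_val {k : ℕ} {Ω : Set ℝ} (x y : Ω) (n : ℕ) :
    (CkSpace.centered x ^ n : CkSpace k Ω).val y = ((y : ℝ) - x) ^ n := by
  change (CkSpace.centered x : CkSpace k Ω).val y ^ n = _
  rw [CkSpace.centered_val]

theorem IsLocalOperator.apply_centered_pow_eq_zero {k : ℕ} {Ω : Set ℝ} (hΩ : IsOpen Ω)
    {A : CkSpace k Ω → C(Ω, ℝ)} (hA : IsLocalOperator A) (hA0 : A 0 = 0) (x : Ω) {n : ℕ}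
    (hn : k < n) : A (CkSpace.centered x ^ n) x = 0 := by
  refine hA.eq_zero_of_isLittleO hΩ hA0 _ x ?_
  have h1 : (fun y : ℝ => (y - x) ^ n) =o[𝓝 (x : ℝ)] fun y => (y - x) ^ k := by
    obtain ⟨j, rfl⟩ := Nat.exists_eq_add_of_lt hn
    have h2 : (fun y : ℝ => (y - x) ^ (j + 1)) =o[𝓝 (x : ℝ)] fun _ => (1 : ℝ) := by
      rw [isLittleO_one_iff]
      have : Continuous fun y : ℝ => (y - x) ^ (j + 1) := by fun_prop
      simpa using this.tendsto (x : ℝ)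
    have h3 := (isBigO_refl (fun y : ℝ => (y - x) ^ k) (𝓝 (x : ℝ))).mul_isLittleO h2
    refine h3.congr (fun y => ?_) fun y => mul_one _
    rw [← pow_add, add_assoc]
  refine h1.congr' ?_ .rfl
  filter_upwards [hΩ.mem_nhds x.2] with y hy
  rw [extendByZero_apply _ ⟨y, hy⟩, CkSpace.centered_pow_val]

theorem IsLocalOperator.apply_eq_taylor {k : ℕ} {Ω : Set ℝ} (hΩ : IsOpen Ω)
    {A : CkSpace k Ω →ₗ[ℝ] C(Ω, ℝ)} (hA : IsLocalOperator A) (x : Ω)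
    (h3 : ∀ n, 3 ≤ n → A (CkSpace.centered x ^ n) x = 0) (f : CkSpace k Ω) :
    A f x = f.val x * A 1 x + firstDeriv f.val x * A (CkSpace.centered x) x
      + secondDeriv f.val x * (A (CkSpace.centered x ^ 2) x / 2) := by
  obtain ⟨G, hG, hGf⟩ := exists_contDiff_eventuallyEq (CkSpace.contDiffAt hΩ f x)
  let a : ℕ → ℝ := fun i => (i.factorial : ℝ)⁻¹ * iteratedDeriv i G x
  have hflat : A (f - ∑ i ∈ Finset.range (k + 1), a i • CkSpace.centered x ^ i) x = 0 := by
    refine hA.eq_zero_of_isLittleO hΩ (map_zero A) _ x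
      ((taylor_isLittleO_univ (x₀ := (x : ℝ)) hG).congr' ?_ .rfl)
    filter_upwards [hGf, hΩ.mem_nhds x.2] with y hy hyΩ
    rw [hy, extendByZero_apply _ ⟨y, hyΩ⟩, extendByZero_apply _ ⟨y, hyΩ⟩, taylor_within_apply]
    change _ = f.val _ - (_ : CkSpace k Ω).val _
    rw [AddSubmonoidClass.coe_finsetSum, Finset.sum_apply]
    congr 1
    refine Finset.sum_congr rfl fun i _ => ?_
    change _ = a i * (CkSpace.centered x ^ i : CkSpace k Ω).val _
    rw [CkSpace.centered_pow_val, iteratedDerivWithin_univ, smul_eq_mul]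
    simp only [a]
    ring
  rw [map_sub, ContinuousMap.sub_apply, sub_eq_zero, map_sum, ContinuousMap.sum_apply] at hflat
  simp only [map_smul, ContinuousMap.smul_apply, smul_eq_mul] at hflat
  -- Padding to k + 4 terms before truncating to 3 treats all k at once: terms with i > k vanish by
  -- flatness of (y - x)^i, those with i ≥ 3 by `h3`.
  rw [hflat, Finset.sum_subset (Finset.range_mono (show k + 1 ≤ k + 4 by omega)),
    ← Finset.sum_subset (Finset.range_mono (show 3 ≤ k + 4 by omega))]
  · have d0 : G x = f.val x := by rw [hGf.eq_of_nhds, extendByZero_apply]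
    have d1 : deriv G x = firstDeriv f.val x := hGf.deriv_eq
    have d2 : deriv (deriv G) x = secondDeriv f.val x := hGf.deriv.deriv_eq
    have d2' : iteratedDeriv 2 G x = secondDeriv f.val x := by
      rw [iteratedDeriv_succ, iteratedDeriv_one, d2]
    simp only [Finset.sum_range_succ, Finset.sum_range_zero, a, iteratedDeriv_zero,
      iteratedDeriv_one, d0, d1, d2', pow_zero, pow_one, Nat.factorial]
    push_cast
    ring
  · intro i _ hi
    rw [h3 i (by simpa using hi), mul_zero]
  · intro i _ hi
    rw [hA.apply_centered_pow_eq_zero hΩ (map_zero A) x (by simpa using hi), mul_zero]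

theorem ThreeVariableIdentity.apply_one {k : ℕ} {Ω : Set ℝ} {D : CkSpace k Ω → C(Ω, ℝ)}
    (hD : ThreeVariableIdentity D) (x : Ω) : D 1 x = 0 := by
  have h := hD 1 1 1 x
  have e : (1 : CkSpace k Ω).val x = 1 := rfl
  simp only [mul_one, e] at h
  linarith

theorem ThreeVariableIdentity.apply_zero {k : ℕ} {Ω : Set ℝ} {D : CkSpace k Ω → C(Ω, ℝ)}
    (hD : ThreeVariableIdentity D) (x : Ω) : D 0 x = 0 := by
  have h := hD 0 0 0 x
  have e : (0 : CkSpace k Ω).val x = 0 := rfl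
  simp only [mul_zero, e] at h
  linarith

/-- The triple (-1, -1, -1) gives D(-1) = 0, and then (f, -1, -1) gives oddness. -/
theorem ThreeVariableIdentity.apply_neg {k : ℕ} {Ω : Set ℝ} {D : CkSpace k Ω → C(Ω, ℝ)}
    (hD : ThreeVariableIdentity D) (f : CkSpace k Ω) (x : Ω) : D (-f) x = -D f x := by
  have h1 := hD.apply_one x
  have h2 := hD (-1) (-1) (-1) x
  have h3 := hD f (-1) (-1) x
  have e : (-1 : CkSpace k Ω).val x = -1 := rfl
  have e₁ : (-1 : CkSpace k Ω) * -1 = 1 :=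
    Subtype.ext (funext fun y => show (-1 : ℝ) * -1 = 1 by norm_num)
  have e₂ (g : CkSpace k Ω) : g * -1 = -g :=
    Subtype.ext (funext fun y => show g.val y * -1 = -g.val y by ring)
  have e₃ : -(-f) = f := Subtype.ext (funext fun y => neg_neg (f.val y))
  simp only [e₁, one_mul, e, h1] at h2 h3
  have h4 : D (-1) x = 0 := by linarith
  simp only [e₂, e₃, h4] at h3
  linarith

/-- For 1 + u, 1 + v, 1 + w every factor in the identity has value 1 at x, and the alternating sum
of A over the expanded products leaves only the triple product. -/
theorem ThreeVariableIdentity.apply_mul_mul_eq_zero {k : ℕ} {Ω : Set ℝ}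
    {D : CkSpace k Ω → C(Ω, ℝ)} (hD : ThreeVariableIdentity D) {A : CkSpace k Ω →ₗ[ℝ] C(Ω, ℝ)}
    (x : Ω) (hx : ∀ f : CkSpace k Ω, f.val x = 1 → D f x = A f x - A 1 x) (u v w : CkSpace k Ω)
    (hu : u.val x = 0) (hv : v.val x = 0) (hw : w.val x = 0) : A (u * v * w) x = 0 := by
  have h1 (f : CkSpace k Ω) (hf : f.val x = 0) : (1 + f).val x = 1 := by
    change 1 + f.val x = 1
    rw [hf, add_zero]
  have hm (f g : CkSpace k Ω) (hf : f.val x = 1) (hg : g.val x = 1) : (f * g).val x = 1 := by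
    change f.val x * g.val x = 1
    rw [hf, hg, mul_one]
  have hu' := h1 u hu
  have hv' := h1 v hv
  have hw' := h1 w hw
  have h := hD (1 + u) (1 + v) (1 + w) x
  rw [hx _ (hm _ _ (hm _ _ hu' hv') hw'), hx _ (hm _ _ hv' hw'), hx _ (hm _ _ hu' hw'),
    hx _ (hm _ _ hu' hv'), hx _ hu', hx _ hv', hx _ hw', hu', hv', hw'] at h
  simp only [add_mul, mul_add, one_mul, mul_one, map_add, ContinuousMap.add_apply] at h
  linarith

/-! ### Continuity of the right-hand side -/

theorem continuous_mul_log_sq : Continuous fun t : ℝ => t * Real.log t ^ 2 := by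
  rw [continuous_iff_continuousAt]
  intro t
  rcases eq_or_ne t 0 with rfl | ht
  · rw [ContinuousAt, zero_mul]
    -- This is |t| log² |t|, reduced to the continuity of t log t by taking a square root.
    have hc : Continuous fun t : ℝ => 4 * (√|t| * Real.log √|t|) ^ 2 := by
      have : Continuous fun t : ℝ => √|t| * Real.log √|t| :=
        Real.continuous_mul_log.comp (Real.continuous_sqrt.comp continuous_abs)
      fun_prop
    have h0 := hc.tendsto 0
    simp only [abs_zero, Real.sqrt_zero, zero_mul, ne_eq, OfNat.ofNat_ne_zero, not_false_eq_true,
      zero_pow, mul_zero] at h0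
    refine squeeze_zero_norm (fun s => le_of_eq ?_) h0
    rw [mul_pow, Real.sq_sqrt (abs_nonneg s), Real.log_sqrt (abs_nonneg s), Real.log_abs, norm_mul,
      Real.norm_eq_abs, Real.norm_eq_abs, abs_pow, sq_abs]
    ring
  · exact continuousAt_id.mul ((Real.continuousAt_log ht).pow 2)

/-- The right-hand side of `HasForm`. -/
noncomputable def formValue {Ω : Set ℝ} (c₀ c₁ c₂ d₀₀ : C(Ω, ℝ)) (f : Ω → ℝ) (x : Ω) : ℝ :=
  c₀ x * f x * Real.log |f x| + c₁ x * firstDeriv f x + c₂ x * secondDeriv f x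
    + d₀₀ x * f x * (Real.log |f x|) ^ 2

theorem AdmissibleCoeffs.continuous_formValue {k : ℕ} {Ω : Set ℝ} (hΩ : IsOpen Ω)
    {c₁ c₂ : C(Ω, ℝ)} (h : AdmissibleCoeffs k c₁ c₂) (c₀ d₀₀ : C(Ω, ℝ)) (f : CkSpace k Ω) :
    Continuous (formValue c₀ c₁ c₂ d₀₀ f.val) := by
  have hf := CkSpace.continuous f
  have hk : ContDiffOn ℝ k (extendByZero f.val) Ω := f.2
  have h0 : Continuous fun x => c₀ x * (f.val x * Real.log (f.val x)) :=
    c₀.continuous.mul (Real.continuous_mul_log.comp hf)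
  have h3 : Continuous fun x => d₀₀ x * (f.val x * Real.log (f.val x) ^ 2) :=
    d₀₀.continuous.mul (continuous_mul_log_sq.comp hf)
  have h1 : Continuous fun x => c₁ x * firstDeriv f.val x := by
    rcases Nat.eq_zero_or_pos k with hk0 | hk0
    · simpa [(h.1 hk0).1] using continuous_const
    · refine c₁.continuous.mul ?_
      exact (hk.continuousOn_deriv_of_isOpen hΩ (by exact_mod_cast hk0)).domRestrict
  have h2 : Continuous fun x => c₂ x * secondDeriv f.val x := by
    by_cases hk2 : 2 ≤ k
    · refine c₂.continuous.mul ?_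
      have h4 : ContDiffOn ℝ 1 (deriv (extendByZero f.val)) Ω :=
        hk.deriv_of_isOpen hΩ (by exact_mod_cast hk2)
      exact (h4.continuousOn_deriv_of_isOpen hΩ le_rfl).domRestrict
    · have : c₂ = 0 := by
        rcases (show k = 0 ∨ k = 1 by omega) with hk' | hk'
        · exact (h.1 hk').2
        · exact h.2 hk'
      simpa [this] using continuous_const
  refine (((h0.add h1).add h2).add h3).congr fun x => ?_
  simp only [formValue, Real.log_abs, mul_assoc, Pi.add_apply]

/-! ### Necessity of the form -/

theorem ThreeVariableIdentity.exists_hasForm {k : ℕ} {Ω : Set ℝ} (hΩ : IsOpen Ω)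
    {D : CkSpace k Ω → C(Ω, ℝ)} (hD : ThreeVariableIdentity D) :
    ∃ c₀ c₁ c₂ d₀₀ : C(Ω, ℝ), HasForm D c₀ c₁ c₂ d₀₀ ∧ AdmissibleCoeffs k c₁ c₂ := by
  have hloc := hD.isLocalOperator
  obtain ⟨A, B, hA, hB, hsymm, hexp⟩ := hD.exists_linear_bilinear hΩ
  let ι : C(Ω, ℝ) := ⟨Subtype.val, continuous_subtype_val⟩
  -- The coefficients are x ↦ A(y - x)(x) and x ↦ A((y - x)²)(x)/2. Expanding in powers of x by
  -- linearity of A makes their continuity evident.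
  let c₁ : C(Ω, ℝ) := A (CkSpace.id k Ω) - ι * A 1
  let c₂ : C(Ω, ℝ) := (2⁻¹ : ℝ) • (A (CkSpace.id k Ω ^ 2) - (2 : ℝ) • (ι * A (CkSpace.id k Ω))
    + ι ^ 2 * A 1)
  have hc₁ (x : Ω) : c₁ x = A (CkSpace.centered x) x := by
    simp only [CkSpace.centered, map_sub, map_smul, ContinuousMap.sub_apply,
      ContinuousMap.smul_apply, smul_eq_mul]
    rfl
  have hc₂ (x : Ω) : c₂ x = A (CkSpace.centered x ^ 2) x / 2 := by
    have h1 : CkSpace.centered x ^ 2 = CkSpace.id k Ω ^ 2 - (2 * (x : ℝ)) • CkSpace.id k Ω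
        + ((x : ℝ) ^ 2) • 1 := by
      refine Subtype.ext (funext fun y => ?_)
      change ((y : ℝ) - x * 1) ^ 2 = (y : ℝ) ^ 2 - 2 * x * y + x ^ 2 * 1
      ring
    rw [h1]
    simp only [map_add, map_sub, map_smul, ContinuousMap.sub_apply, ContinuousMap.add_apply,
      ContinuousMap.smul_apply, smul_eq_mul]
    change 2⁻¹ * (A _ x - 2 * (x * A _ x) + (x : ℝ) ^ 2 * A 1 x) = _
    ring
  have hadm : AdmissibleCoeffs k c₁ c₂ := by
    have hzero (x : Ω) (n : ℕ) (hn : k < n) : A (CkSpace.centered x ^ n) x = 0 :=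
      hA.apply_centered_pow_eq_zero hΩ (map_zero A) x hn
    refine ⟨fun hk => ⟨?_, ?_⟩, fun hk => ?_⟩
    · ext x
      rw [hc₁, ← pow_one (CkSpace.centered x), hzero x 1 (by omega)]
      rfl
    · ext x
      rw [hc₂, hzero x 2 (by omega), zero_div]
      rfl
    · ext x
      rw [hc₂, hzero x 2 (by omega), zero_div]
      rfl
  refine ⟨A 1, c₁, c₂, B 1 1, ?_, hadm⟩
  have good (x : Ω) (hx : ∀ u w : CkSpace k Ω, ∃ ε > 0, ∃ C, ∀ s t : ℝ, |s| < ε → |t| < ε →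
      |D (s • u + t • w) x| ≤ C) (f : CkSpace k Ω) (hf : f.val x ≠ 0) :
      D f x = formValue (A 1) c₁ c₂ (B 1 1) f.val x := by
    have hpos (g : CkSpace k Ω) (hg : 0 < g.val x) :=
      hloc.apply_eq_of_pos hΩ hA hB hsymm hexp x hx g hg
    have h3 (n : ℕ) (hn : 3 ≤ n) : A (CkSpace.centered x ^ n) x = 0 := by
      obtain ⟨j, rfl⟩ := Nat.exists_eq_add_of_le hn
      have h0 : (CkSpace.centered x : CkSpace k Ω).val x = 0 := by
        rw [CkSpace.centered_val, sub_self]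
      have h1 := hD.apply_mul_mul_eq_zero x (A := A) (fun g hg => by
        rw [hpos g (by rw [hg]; exact one_pos), hg, Real.log_one]
        ring) (CkSpace.centered x) (CkSpace.centered x) (CkSpace.centered x ^ (j + 1)) h0 h0 (by
          rw [CkSpace.centered_pow_val, sub_self, zero_pow (by omega)])
      rwa [← pow_two, ← pow_add, show 2 + (j + 1) = 3 + j by omega] at h1
    have hAx (g : CkSpace k Ω) := hA.apply_eq_taylor hΩ x h3 g
    simp only [← hc₁, ← hc₂] at hAx
    rcases lt_or_gt_of_ne hf with h | h
    · have hn : 0 < (-f).val x := neg_pos.2 h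
      have h1 := hpos (-f) hn
      rw [hD.apply_neg, map_neg, ContinuousMap.neg_apply, hAx f] at h1
      have h2 : (-f).val x = -f.val x := rfl
      rw [h2, Real.log_neg_eq_log] at h1
      rw [formValue, Real.log_abs]
      linarith
    · rw [hpos f h, hAx f, formValue, abs_of_pos h]
      ring
  intro f
  let R : C(Ω, ℝ) := ⟨formValue (A 1) c₁ c₂ (B 1 1) f.val,
    hadm.continuous_formValue hΩ (A 1) (B 1 1) f⟩
  by_contra hcon
  push Not at hcon
  obtain ⟨x₀, hx₀⟩ := hcon
  have hV : IsOpen {x | D f x ≠ R x} := isOpen_ne_fun (D f).continuous R.continuous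
  -- The set where the formula fails is open. If f is nonzero somewhere on it, it contains a point
  -- of the dense set with f ≠ 0; otherwise f vanishes near x₀, and locality compares it with 0.
  by_cases hf : ∃ y, D f y ≠ R y ∧ f.val y ≠ 0
  · obtain ⟨y, hy⟩ := hf
    have hW : IsOpen {x | D f x ≠ R x ∧ f.val x ≠ 0} :=
      hV.inter (isOpen_ne_fun (CkSpace.continuous f) continuous_const)
    obtain ⟨z, ⟨hz, hfz⟩, hgz⟩ := (hloc.dense_bounded hΩ).inter_open_nonempty _ hW ⟨y, hy⟩
    exact hz (good z hgz f hfz)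
  · push Not at hf
    have h0 : extendByZero f.val =ᶠ[𝓝 (x₀ : ℝ)] extendByZero (0 : CkSpace k Ω).val :=
      eventuallyEq_of_eventually_apply hΩ x₀
        (by filter_upwards [hV.mem_nhds hx₀] with y hy using hf y hy)
    have h00 : extendByZero f.val =ᶠ[𝓝 (x₀ : ℝ)] fun _ => 0 :=
      h0.trans (extendByZero_eventuallyEq_of_eqOn hΩ x₀ fun _ => rfl)
    have d1 : firstDeriv f.val x₀ = 0 := by
      rw [firstDeriv, h00.deriv_eq, deriv_const]
    have d2 : secondDeriv f.val x₀ = 0 := by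
      rw [secondDeriv, h00.deriv.deriv_eq]
      simp
    refine hx₀ ?_
    rw [hloc f 0 x₀ h0, hD.apply_zero, d1, d2, hf x₀ hx₀]
    ring

/-! ### Sufficiency of the form -/

theorem firstDeriv_mul {k : ℕ} {Ω : Set ℝ} (hΩ : IsOpen Ω) (hk : 1 ≤ k) (f g : CkSpace k Ω)
    (x : Ω) : firstDeriv (f * g).val x
      = firstDeriv f.val x * g.val x + f.val x * firstDeriv g.val x := by
  have hk' : (k : WithTop ℕ∞) ≠ 0 := by exact_mod_cast (by omega : k ≠ 0)
  have hf := (CkSpace.contDiffAt hΩ f x).differentiableAt hk'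
  have hg := (CkSpace.contDiffAt hΩ g x).differentiableAt hk'
  rw [firstDeriv, show (f * g).val = f.val * g.val from rfl, extendByZero_mul, deriv_mul hf hg,
    extendByZero_apply, extendByZero_apply]
  rfl

theorem secondDeriv_mul {k : ℕ} {Ω : Set ℝ} (hΩ : IsOpen Ω) (hk : 2 ≤ k) (f g : CkSpace k Ω)
    (x : Ω) : secondDeriv (f * g).val x
      = secondDeriv f.val x * g.val x + 2 * firstDeriv f.val x * firstDeriv g.val x
        + f.val x * secondDeriv g.val x := by
  have hk' : (k : WithTop ℕ∞) ≠ 0 := by exact_mod_cast (by omega : k ≠ 0)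
  have hd (h : CkSpace k Ω) (y : Ω) : DifferentiableAt ℝ (extendByZero h.val) y :=
    (CkSpace.contDiffAt hΩ h y).differentiableAt hk'
  have hd2 (h : CkSpace k Ω) : DifferentiableAt ℝ (deriv (extendByZero h.val)) x := by
    have h4 : ContDiffOn ℝ 1 (deriv (extendByZero h.val)) Ω :=
      ContDiffOn.deriv_of_isOpen h.2 hΩ (by exact_mod_cast hk)
    exact (h4.contDiffAt (hΩ.mem_nhds x.2)).differentiableAt one_ne_zero
  have he : deriv (extendByZero (f * g).val) =ᶠ[𝓝 (x : ℝ)]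
      deriv (extendByZero f.val) * extendByZero g.val
        + extendByZero f.val * deriv (extendByZero g.val) := by
    filter_upwards [hΩ.mem_nhds x.2] with y hy
    rw [show (f * g).val = f.val * g.val from rfl, extendByZero_mul,
      deriv_mul (hd f ⟨y, hy⟩) (hd g ⟨y, hy⟩)]
    rfl
  rw [secondDeriv, he.deriv_eq, deriv_add ((hd2 f).mul (hd g x)) ((hd f x).mul (hd2 g)),
    deriv_mul (hd2 f) (hd g x), deriv_mul (hd f x) (hd2 g), extendByZero_apply, extendByZero_apply]
  simp only [firstDeriv, secondDeriv]
  ring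

theorem HasForm.threeVariableIdentity {k : ℕ} {Ω : Set ℝ} (hΩ : IsOpen Ω)
    {D : CkSpace k Ω → C(Ω, ℝ)} {c₀ c₁ c₂ d₀₀ : C(Ω, ℝ)} (hD : HasForm D c₀ c₁ c₂ d₀₀)
    (h : AdmissibleCoeffs k c₁ c₂) : ThreeVariableIdentity D := by
  intro f g h' x
  have e (u v : CkSpace k Ω) : (u * v).val x = u.val x * v.val x := rfl
  -- Leibniz rules are stated after multiplication by the coefficient, which is zero whenever k is
  -- too small for the derivative to obey them.
  have h1 (u v : CkSpace k Ω) : c₁ x * firstDeriv (u * v).val x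
      = c₁ x * (firstDeriv u.val x * v.val x + u.val x * firstDeriv v.val x) := by
    rcases Nat.eq_zero_or_pos k with hk | hk
    · rw [(h.1 hk).1]
      simp
    · rw [firstDeriv_mul hΩ hk]
  have h2 (u v : CkSpace k Ω) : c₂ x * secondDeriv (u * v).val x
      = c₂ x * (secondDeriv u.val x * v.val x + 2 * firstDeriv u.val x * firstDeriv v.val x
        + u.val x * secondDeriv v.val x) := by
    by_cases hk : 2 ≤ k
    · rw [secondDeriv_mul hΩ hk]
    · have : c₂ = 0 := by
        rcases (show k = 0 ∨ k = 1 by omega) with hk' | hk'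
        · exact (h.1 hk').2
        · exact h.2 hk'
      simp [this]
  have h12 (u v : CkSpace k Ω) : c₂ x * firstDeriv (u * v).val x
      = c₂ x * (firstDeriv u.val x * v.val x + u.val x * firstDeriv v.val x) := by
    by_cases hk : 2 ≤ k
    · rw [firstDeriv_mul hΩ (by omega)]
    · have : c₂ = 0 := by
        rcases (show k = 0 ∨ k = 1 by omega) with hk' | hk'
        · exact (h.1 hk').2
        · exact h.2 hk'
      simp [this]
  have h3 : c₁ x * firstDeriv (f * g * h').val x = c₁ x * (firstDeriv f.val x * g.val x * h'.val x
      + f.val x * firstDeriv g.val x * h'.val x + f.val x * g.val x * firstDeriv h'.val x) := by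
    rw [h1, e]
    linear_combination h'.val x * h1 f g
  have h4 : c₂ x * secondDeriv (f * g * h').val x
      = c₂ x * (secondDeriv f.val x * g.val x * h'.val x + f.val x * secondDeriv g.val x * h'.val x
        + f.val x * g.val x * secondDeriv h'.val x
        + 2 * firstDeriv f.val x * firstDeriv g.val x * h'.val x
        + 2 * firstDeriv f.val x * g.val x * firstDeriv h'.val x
        + 2 * f.val x * firstDeriv g.val x * firstDeriv h'.val x) := by
    rw [h2, e]
    linear_combination h'.val x * h2 f g + 2 * firstDeriv h'.val x * h12 f g
  simp only [hD _ x, h3, h4, h1, h2, e, Real.log_abs]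
  generalize f.val x = a, g.val x = b, h'.val x = c
  -- If one of the values is 0, the logarithms of products do not split, but every term containing
  -- that value in a logarithm also has it as a factor.
  rcases eq_or_ne a 0 with rfl | ha
  · ring
  rcases eq_or_ne b 0 with rfl | hb
  · ring
  rcases eq_or_ne c 0 with rfl | hc
  · ring
  rw [Real.log_mul (mul_ne_zero ha hb) hc, Real.log_mul ha hb, Real.log_mul hb hc,
    Real.log_mul ha hc]
  ring

theorem mainTheorem1 (k : ℕ) (Ω : Set ℝ) (hΩ : IsOpen Ω) (hne : Ω.Nonempty) :
    (∀ D : CkSpace k Ω → C(Ω, ℝ), ThreeVariableIdentity D →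
      ∃ c₀ c₁ c₂ d₀₀ : C(Ω, ℝ), HasForm D c₀ c₁ c₂ d₀₀ ∧ AdmissibleCoeffs k c₁ c₂) ∧
    (∀ c₀ c₁ c₂ d₀₀ : C(Ω, ℝ), AdmissibleCoeffs k c₁ c₂ →
      (∃ D : CkSpace k Ω → C(Ω, ℝ), HasForm D c₀ c₁ c₂ d₀₀) ∧
      ∀ D : CkSpace k Ω → C(Ω, ℝ), HasForm D c₀ c₁ c₂ d₀₀ → ThreeVariableIdentity D) :=
  ⟨fun _ hD => hD.exists_hasForm hΩ, fun c₀ _ _ d₀₀ h =>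
    ⟨⟨fun f => ⟨_, h.continuous_formValue hΩ c₀ d₀₀ f⟩, fun _ _ => rfl⟩,
      fun _ hD => hD.threeVariableIdentity hΩ h⟩⟩
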